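/- Let $\Gamma$ be a metric graph with finitely many vertices and finitely many edges; each edge either has a finite length and connects two (possibly equal) vertices, or is a half-line attached to one vertex. Let $B=\{v_1,\dots,v_b\}$ be a set of vertices, and let $d_j$ be the degree of $v_j$ (the number of edge ends at $v_j$, so that a loop counts twice). Let $\ell_{\min}$ be the minimal edge length of $\Gamma$, half-lines having length $\infty$; if all edges are half-lines, read $e^{-\mu\ell_{\min}}=0$. For $\mu>0$ let $\Gamma_\mu$ be the graph obtained from $\Gamma$ by multiplying all finite edge lengths by $\mu$. For $\mathbf p=(p_1,\dots,p_b)\in\mathbb R^b$ consider the boundary value problem for a real-valued $u$ that is $H^2$ on every edge of $\Gamma_\mu$: $$(-\Delta+1)u=0 \text{ on every edge},\qquad u(v_j)=p_j \text{ for every } v_j\in B,$$ with Neumann–Kirchhoff conditions at every vertex $v\notin B$ ($u$ is continuous at $v$ and its outward derivatives at $v$ sum to $0$). Here $\Delta u=u''$ on each edge, $u(v_j)=p_j$ is required along every edge end at $v_j$, and the outward derivative at an edge end is the derivative in the direction that leaves the edge through that end. Then: 1. For all $\mu>0$ and $\mathbf p\in\mathbb R^b$ the problem has a unique solution $u\in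 H^2(\Gamma_\mu)$. 2. As $\mu\to\infty$, $$\|u\|_{H^2(\Gamma_\mu)}^2\sim\|u\|_{L^2(\Gamma_\mu)}^2\le C\left(1+\mathcal O(\mu e^{-\mu\ell_{\min}})\right)\|\mathbf p\|^2 .$$ Here $\sim$ means that there are constants $c,C'>0$ such that $c\|u\|_{L^2}^2\le\|u\|_{H^2}^2\le C'\|u\|_{L^2}^2$ for all sufficiently large $\mu$ and all $\mathbf p$. 3. Let $M(\mu):\mathbb R^b\to\mathbb R^b$ be the Dirichlet-to-Neumann map $\mathbf p\mapsto\mathbf q$, where $q_j$ is the sum of the outward derivatives of $u$ at all edge ends at $v_j$. It is a well-defined linear map for every $\mu>0$, and, in the operator norm, $$M(\mu)=\operatorname{diag}(d_j)_{j=1}^b+\mathcal O\left(e^{-\mu\ell_{\min}}\right)\qquad\text{as }\mu\to\infty .$$ The constants $c,C,C'$, the threshold for $\mu$ and the constants in the $\mathcal O$-terms depend only on $\Gamma$ and $B$, not on $\mu$ or $\mathbf p$. -/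

import Mathlib

open MeasureTheory Filter Topology Asymptotics
open scoped ContDiff

noncomputable section

/-! ### Metric graphs -/

/-- A metric graph with vertex set `V`, edges of finite length indexed by `F` and half-lines
indexed by `I`.  Loops, multiple edges and disconnected graphs are allowed.
Every edge `e : F ⊕ I` starts at the vertex `init e` (coordinate `0`); an edge `e : F` of finite
length ends at the vertex `term e` (coordinate `len e`). -/
structure MetricGraph (V F I : Type*) where
  init : F ⊕ I → V
  term : F → V
  len : F → ℝ
  len_pos : ∀ e, 0 < len e

/-! ### The Sobolev space `H²(J)` on an open interval `J` -/

/-- `L²(J)`. -/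
abbrev LTwo (J : Set ℝ) := Lp ℝ 2 (volume.restrict J)

/-- `g` is the weak (distributional) derivative of `f` on the open set `J`. -/
def IsWeakDeriv (J : Set ℝ) (f g : LTwo J) : Prop :=
  ∀ φ : ℝ → ℝ, ContDiff ℝ ∞ φ → HasCompactSupport φ → tsupport φ ⊆ J →
    ∫ x in J, f x * deriv φ x = -∫ x in J, g x * φ x

/-- An element of `H²(J)`: a class `fn` in `L²(J)` with weak derivatives `d1`, `d2` of first
and second order in `L²(J)` (these are determined by `fn`). -/
@[ext] structure HTwo (J : Set ℝ) where
  fn : LTwo J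
  d1 : LTwo J
  d2 : LTwo J
  weak1 : IsWeakDeriv J fn d1
  weak2 : IsWeakDeriv J d1 d2

/-- The class `f` has the trace (boundary value) `a` at the end point `x` of `J`: its continuous
representative on `J` tends to `a` at `x`. -/
def HasTrace (J : Set ℝ) (f : LTwo J) (x a : ℝ) : Prop :=
  ∃ w : ℝ → ℝ, ContinuousOn w J ∧ f =ᵐ[volume.restrict J] w ∧ Tendsto w (𝓝[J] x) (𝓝 a)

namespace MetricGraph

variable {V F I : Type*}

/-- The open interval that parametrizes an edge. -/
def dom (G : MetricGraph V F I) : F ⊕ I → Set ℝ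
  | Sum.inl e => Set.Ioo 0 (G.len e)
  | Sum.inr _ => Set.Ioi 0

/-- The graph with all (finite) edge lengths multiplied by `μ`; half-lines are unaffected. -/
def scale (G : MetricGraph V F I) (μ : ℝ) (hμ : 0 < μ) : MetricGraph V F I where
  init := G.init
  term := G.term
  len e := μ * G.len e
  len_pos e := mul_pos hμ (G.len_pos e)

/-- The number `e^{-μ ℓ_min}`, where `ℓ_min` is the minimal edge length.  Half-lines have
infinite length, so this is `e^{-∞} = 0` if the graph has no edge of finite length. -/
def expDecay (G : MetricGraph V F I) (μ : ℝ) : ℝ :=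
  open Classical in if Nonempty F then Real.exp (-(μ * ⨅ e, G.len e)) else 0

/-- The space of componentwise `H²` functions on the graph. -/
abbrev Sobolev (G : MetricGraph V F I) := ∀ e : F ⊕ I, HTwo (G.dom e)

/-- The squared `L²` norm on the graph. -/
def sqNormL2 [Fintype F] [Fintype I] (G : MetricGraph V F I) (u : G.Sobolev) : ℝ :=
  ∑ e, ‖(u e).fn‖ ^ 2

/-- The squared `H²` norm on the graph. -/
def sqNormH2 [Fintype F] [Fintype I] (G : MetricGraph V F I) (u : G.Sobolev) : ℝ :=
  ∑ e, (‖(u e).fn‖ ^ 2 + ‖(u e).d1‖ ^ 2 + ‖(u e).d2‖ ^ 2)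

/-- The vertex at which an edge end is attached.  Edge ends are indexed by `(F ⊕ I) ⊕ F`:
`Sum.inl e` is the initial end of the edge `e`, and `Sum.inr e` is the terminal end of the
edge `e` of finite length. -/
def endVertex (G : MetricGraph V F I) : (F ⊕ I) ⊕ F → V :=
  Sum.elim G.init G.term

/-- The degree of a vertex: the number of edge ends attached to it (a loop counts twice). -/
def degree [Fintype F] [Fintype I] [DecidableEq V] (G : MetricGraph V F I) (v : V) : ℕ :=
  (Finset.univ.filter fun s => G.endVertex s = v).card

/-- `u` has the value `a` at the edge end `s`. -/
def HasValue (G : MetricGraph V F I) (u : G.Sobolev) : (F ⊕ I) ⊕ F → ℝ → Prop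
  | Sum.inl e, a => HasTrace (G.dom e) (u e).fn 0 a
  | Sum.inr e, a => HasTrace (G.dom (Sum.inl e)) (u (Sum.inl e)).fn (G.len e) a

/-- `u` has the outward derivative `q` at the edge end `s`: the derivative in the direction
that leaves the edge through that end, so `-u'(0)` at the initial end and `u'(ℓ)` at the
terminal end. -/
def HasOutwardDeriv (G : MetricGraph V F I) (u : G.Sobolev) : (F ⊕ I) ⊕ F → ℝ → Prop
  | Sum.inl e, q => HasTrace (G.dom e) (u e).d1 0 (-q)
  | Sum.inr e, q => HasTrace (G.dom (Sum.inl e)) (u (Sum.inl e)).d1 (G.len e) q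

/-- The Neumann data of `u` at the vertex `v` is `q`: the outward derivatives at the edge ends
attached to `v` sum to `q`. -/
def HasNeumannData [Fintype F] [Fintype I] [DecidableEq V] (G : MetricGraph V F I)
    (u : G.Sobolev) (v : V) (q : ℝ) : Prop :=
  ∃ d : (F ⊕ I) ⊕ F → ℝ, (∀ s, G.endVertex s = v → G.HasOutwardDeriv u s (d s)) ∧
    ∑ s with G.endVertex s = v, d s = q

/-- Neumann–Kirchhoff conditions at the vertex `v`: continuity at `v`, and the outward
derivatives at `v` sum to zero. -/
def NeumannKirchhoff [Fintype F] [Fintype I] [DecidableEq V] (G : MetricGraph V F I)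
    (u : G.Sobolev) (v : V) : Prop :=
  (∃ a : ℝ, ∀ s, G.endVertex s = v → G.HasValue u s a) ∧ G.HasNeumannData u v 0

/-- `u ∈ H²` solves `(-Δ + 1) u = 0` on every edge, with Neumann–Kirchhoff conditions at every
vertex outside `B` and with the value `p v` at every vertex `v ∈ B`. -/
structure IsSolution [Fintype F] [Fintype I] [DecidableEq V] (G : MetricGraph V F I)
    (B : Finset V) (p : EuclideanSpace ℝ B) (u : G.Sobolev) : Prop where
  eqn : ∀ e, -(u e).d2 + (u e).fn = 0
  kirchhoff : ∀ v, v ∉ B → G.NeumannKirchhoff u v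
  dirichlet : ∀ v : B, ∀ s, G.endVertex s = v → G.HasValue u s (p v)

/-- The linear map `M` is the Dirichlet-to-Neumann map: its graph consists of the pairs of
Dirichlet and Neumann data of the solutions of the boundary value problem. -/
def IsDtNMap [Fintype F] [Fintype I] [DecidableEq V] (G : MetricGraph V F I) (B : Finset V)
    (M : EuclideanSpace ℝ B →L[ℝ] EuclideanSpace ℝ B) : Prop :=
  ∀ p q : EuclideanSpace ℝ B,
    M p = q ↔ ∃ u : G.Sobolev, G.IsSolution B p u ∧ ∀ v : B, G.HasNeumannData u v (q v)

/-- The diagonal matrix of the degrees of the vertices in `B`, as an operator. -/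
def degreeDiag [Fintype F] [Fintype I] [DecidableEq V] (G : MetricGraph V F I) (B : Finset V) :
    EuclideanSpace ℝ B →L[ℝ] EuclideanSpace ℝ B :=
  Matrix.toEuclideanCLM (𝕜 := ℝ) (Matrix.diagonal fun v : B => (G.degree v : ℝ))

end MetricGraph

end

/-! The proof reduces the boundary value problem to a linear system for the values at the vertices.

On an edge, `u` and `u'` are classes in `L²` with weak derivatives. The functions `u + u'` and
`u - u'` solve the first order equations `w' = w` and `w' = -w` weakly, so that, after
multiplication by `e⁻ˣ` or `eˣ`, the du Bois-Reymond lemma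
(`ae_eq_const_of_integral_mul_deriv_eq_zero`) gives `u = A eˣ + B e⁻ˣ` almost everywhere
(`HTwo.exists_expFun`). On a half-line square integrability forces `A = 0`. Hence `u` is
determined on each edge by its values at the edge ends, and the outward derivative at an end is
`coth ℓ · u(v) - u(w) / sinh ℓ`, where `w` is the other end; on a half-line it is `u(v)`.

The problem therefore becomes a square linear system for the vertex values. Since
`coth ℓ > 1 / sinh ℓ`, it is strictly diagonally dominant, and a discrete maximum principle
(`MetricGraph.abs_le_of_flux_eq_zero`) shows at once that the system is uniquely solvable and that
every vertex value is at most `‖p‖`, for every `μ > 0`.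

The asymptotics follow edge by edge. The `L²` norm on an edge with end values `a`, `b` is at most
`√(a² + b²)` because `sinh (ℓ - x) / sinh ℓ ≤ e⁻ˣ`; this bound does not depend on `ℓ`, so the
`L²` estimate holds even without a remainder. For `ℓ ≥ 6` one has `‖u'‖² ≤ 3 ‖u‖²`
(`integral_sq_expFun_deriv_le`), which gives the equivalence of the norms. Finally
`coth ℓ - 1` and `1 / sinh ℓ` are `O(e^{-ℓ})`, so that the Dirichlet-to-Neumann map differs from
the diagonal matrix of degrees by `O(e^{-μ ℓ_min})` (`MetricGraph.norm_dtn_sub_degreeDiag_le`). -/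

noncomputable section

/-! ### Weak derivatives on an open interval -/

/-- A test function of mean zero is the derivative of a test function. -/
theorem exists_primitive_of_integral_eq_zero {J : Set ℝ} (hJ : J.OrdConnected) {ψ : ℝ → ℝ}
    (hψ : ContDiff ℝ ∞ ψ) (hc : HasCompactSupport ψ) (hs : tsupport ψ ⊆ J)
    (h0 : ∫ x, ψ x = 0) :
    ∃ φ : ℝ → ℝ, ContDiff ℝ ∞ φ ∧ HasCompactSupport φ ∧ tsupport φ ⊆ J ∧ deriv φ = ψ := by
  rcases (tsupport ψ).eq_empty_or_nonempty with he | hne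
  · have : ψ = 0 := tsupport_eq_empty_iff.1 he
    refine ⟨0, contDiff_const, HasCompactSupport.zero, ?_, ?_⟩
    · simp
    · rw [this]; ext x; simp
  obtain ⟨a, ha, hla⟩ := hc.isCompact.exists_isLeast hne
  obtain ⟨b, hb, hgb⟩ := hc.isCompact.exists_isGreatest hne
  -- The integration starts at `a - 1` so that the support lies in `Ioc (a - 1) x` for `x > b`.
  let φ : ℝ → ℝ := fun x => ∫ t in (a - 1)..x, ψ t
  have hd : deriv φ = ψ := funext fun x => hψ.continuous.deriv_integral ψ (a - 1) x
  have hdiff : Differentiable ℝ φ := fun x =>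
    (hψ.continuous.integral_hasStrictDerivAt (a - 1) x).hasDerivAt.differentiableAt
  have hz : ∀ x, x ∉ Set.Icc a b → ψ x = 0 := fun x hx => by
    refine image_eq_zero_of_notMem_tsupport fun h => hx ⟨hla h, hgb h⟩
  have hsub : tsupport φ ⊆ Set.Icc a b := by
    refine closure_minimal (fun x hx => ?_) isClosed_Icc
    by_contra hn
    refine hx ?_
    rcases not_and_or.1 hn with h | h
    · push Not at h
      refine (intervalIntegral.integral_congr (g := fun _ => 0) fun t ht => ?_).trans (by simp)
      refine hz t fun h' => ?_
      have : t ≤ max (a - 1) x := ht.2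
      have h3 : max (a - 1) x < a := max_lt (by linarith) h
      exact absurd h'.1 (not_le.2 (lt_of_le_of_lt this h3))
    · push Not at h
      change ∫ t in (a - 1)..x, ψ t = 0
      rw [intervalIntegral.integral_eq_integral_of_support_subset, h0]
      intro t ht
      by_contra hn
      refine ht (hz t fun h' => hn ⟨by linarith [h'.1], by linarith [h'.2]⟩)
  refine ⟨φ, ?_, ?_, hsub.trans (hJ.out (hs ha) (hs hb)), hd⟩
  · exact contDiff_infty_iff_deriv.2 ⟨hdiff, hd ▸ hψ⟩
  · exact HasCompactSupport.of_support_subset_isCompact isCompact_Icc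
      ((subset_tsupport _).trans hsub)

/-- The product of a locally integrable function and a test function is integrable. -/
theorem integrableOn_mul_test {J : Set ℝ} {f ψ : ℝ → ℝ} (hf : LocallyIntegrableOn f J)
    (hψ : Continuous ψ) (hc : HasCompactSupport ψ) (hs : tsupport ψ ⊆ J) :
    IntegrableOn (fun x => f x * ψ x) J := by
  have h1 : IntegrableOn (fun x => f x * ψ x) (tsupport ψ) :=
    (hf.integrableOn_compact_subset hs hc).mul_continuousOn hψ.continuousOn hc
  refine ((integrableOn_iff_integrable_of_support_subset ?_).1 h1).integrableOn
  exact (Function.support_mul_subset_right f ψ).trans (subset_tsupport ψ)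

/-- Du Bois-Reymond: a locally integrable function on an open interval whose weak derivative
vanishes is almost everywhere constant. -/
theorem ae_eq_const_of_integral_mul_deriv_eq_zero {J : Set ℝ} (ho : IsOpen J)
    (hJ : J.OrdConnected) (hne : J.Nonempty) {f : ℝ → ℝ} (hf : LocallyIntegrableOn f J)
    (h : ∀ φ : ℝ → ℝ, ContDiff ℝ ∞ φ → HasCompactSupport φ → tsupport φ ⊆ J →
      ∫ x in J, f x * deriv φ x = 0) :
    ∃ c : ℝ, f =ᵐ[volume.restrict J] fun _ => c := by
  obtain ⟨y, hy⟩ := hne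
  obtain ⟨η, hηs, hηc, hη, hηr, hη1⟩ :=
    exists_contDiff_tsupport_subset (n := ⊤) (ho.mem_nhds hy)
  have hηpos : 0 < ∫ x, η x :=
    hη.continuous.integral_pos_of_hasCompactSupport_nonneg_nonzero hηc
      (fun x => (hηr ⟨x, rfl⟩).1) (x := y) (by rw [hη1]; exact one_ne_zero)
  set m := ∫ x, η x
  set c := (∫ x in J, f x * η x) / m with hcdef
  refine ⟨c, ?_⟩
  have key : ∀ g : ℝ → ℝ, ContDiff ℝ ∞ g → HasCompactSupport g → tsupport g ⊆ J →
      ∫ x, g x • (f x - c) = 0 := by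
    intro ψ hψ hψc hψs
    set k := (∫ x, ψ x) / m with hk
    have hi : ∀ χ : ℝ → ℝ, ContDiff ℝ ∞ χ → HasCompactSupport χ → Integrable χ := fun χ a b =>
      a.continuous.integrable_of_hasCompactSupport b
    -- `ψ - k η` has mean zero, so `f` integrates to zero against it.
    obtain ⟨φ, h1, h2, h3, h4⟩ := exists_primitive_of_integral_eq_zero hJ
      (ψ := fun x => ψ x - k * η x) (hψ.sub (contDiff_const.mul hη))
      (hψc.sub (hηc.mul_left (f := fun _ => k)))
      ((tsupport_sub ψ (fun x => k * η x)).trans (Set.union_subset hψs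
        ((tsupport_mul_subset_right (f := fun _ => k) (g := η)).trans hηs))) (by
        rw [integral_sub (hi _ hψ hψc) ((hi _ hη hηc).const_mul k), integral_const_mul, hk]
        field_simp
        simp [m])
    have h5 := h φ h1 h2 h3
    rw [h4] at h5
    have e1 := integrableOn_mul_test hf hψ.continuous hψc hψs
    have e2 := integrableOn_mul_test hf hη.continuous hηc hηs
    have h6 : ∫ x in J, f x * (ψ x - k * η x)
        = (∫ x in J, f x * ψ x) - k * ∫ x in J, f x * η x := by
      rw [← integral_const_mul, ← integral_sub e1 (e2.const_mul k)]
      congr 1; ext x; ring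
    have e3 : ∀ x ∉ J, ψ x = 0 := fun x hx =>
      image_eq_zero_of_notMem_tsupport fun h' => hx (hψs h')
    rw [← setIntegral_eq_integral_of_forall_compl_eq_zero (s := J)
      (fun x hx => by rw [e3 x hx, zero_smul])]
    have h7 : ∫ x in J, ψ x • (f x - c) = (∫ x in J, f x * ψ x) - c * ∫ x in J, ψ x := by
      rw [← integral_const_mul, ← integral_sub e1 ((hi _ hψ hψc).integrableOn.const_mul c)]
      congr 1; ext x; simp only [smul_eq_mul]; ring
    rw [h7, setIntegral_eq_integral_of_forall_compl_eq_zero e3]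
    rw [h6] at h5
    rw [hcdef, div_mul_eq_mul_div, mul_div_assoc, ← hk]
    linarith
  have := ho.ae_eq_zero_of_integral_contDiff_smul_eq_zero
    (f := fun x => f x - c) (hf.sub (locallyIntegrableOn_const c)) key
  rw [EventuallyEq, ae_restrict_iff' ho.measurableSet]
  filter_upwards [this] with x hx hxJ
  linarith [hx hxJ]

theorem MeasureTheory.MemLp.locallyIntegrableOn_of_restrict {J : Set ℝ} {f : ℝ → ℝ}
    (hf : MemLp f 2 (volume.restrict J)) : LocallyIntegrableOn f J :=
  locallyIntegrableOn_of_locallyIntegrable_restrict (hf.locallyIntegrable (by norm_num))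

/-- The equation `f' = σ f` in the weak sense has only the solutions `c e^{σ x}`: the weak
derivative of `e^{-σ x} f` is zero. -/
theorem ae_eq_exp_of_weak_ode {J : Set ℝ} (ho : IsOpen J)
    (hJ : J.OrdConnected) (hne : J.Nonempty) {f : ℝ → ℝ} (hf : LocallyIntegrableOn f J) (σ : ℝ)
    (h : ∀ φ : ℝ → ℝ, ContDiff ℝ ∞ φ → HasCompactSupport φ → tsupport φ ⊆ J →
      ∫ x in J, f x * deriv φ x = -∫ x in J, σ * f x * φ x) :
    ∃ c : ℝ, f =ᵐ[volume.restrict J] fun x => c * Real.exp (σ * x) := by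
  have hE : ContDiff ℝ ∞ fun x : ℝ => Real.exp (-σ * x) := by fun_prop
  obtain ⟨c, hc⟩ := ae_eq_const_of_integral_mul_deriv_eq_zero ho hJ hne
    (f := fun x => f x * Real.exp (-σ * x))
    (hf.mul_continuousOn hE.continuous.continuousOn ho.isLocallyClosed) (by
      intro φ h1 h2 h3
      have hs : tsupport (fun x => Real.exp (-σ * x) * φ x) ⊆ J :=
        (tsupport_mul_subset_right (f := fun x => Real.exp (-σ * x)) (g := φ)).trans h3
      have hcs : HasCompactSupport (fun x => Real.exp (-σ * x) * φ x) := h2.mul_left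
      have hcd : ContDiff ℝ ∞ (fun x => Real.exp (-σ * x) * φ x) := hE.mul h1
      have h4 := h _ hcd hcs hs
      have hd : ∀ x, deriv (fun x => Real.exp (-σ * x) * φ x) x
          = -σ * (Real.exp (-σ * x) * φ x) + Real.exp (-σ * x) * deriv φ x := by
        intro x
        have a1 : HasDerivAt (fun x => Real.exp (-σ * x)) (Real.exp (-σ * x) * (-σ * 1)) x :=
          ((hasDerivAt_id x).const_mul (-σ)).exp
        have a2 : HasDerivAt φ (deriv φ x) x :=
          (h1.differentiable (by simp) x).hasDerivAt
        rw [(a1.fun_mul a2).deriv]; ring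
      have i1 := integrableOn_mul_test hf (hcd.continuous_deriv (by simp)) hcs.deriv
        (tsupport_deriv_subset.trans hs)
      have i2 := (integrableOn_mul_test hf hcd.continuous hcs hs).const_mul σ
      have : ∀ x, f x * Real.exp (-σ * x) * deriv φ x
          = f x * deriv (fun x => Real.exp (-σ * x) * φ x) x
            + σ * (f x * (Real.exp (-σ * x) * φ x)) := by
        intro x; rw [hd]; ring
      simp_rw [this]
      rw [integral_add i1 i2, h4]
      simp_rw [mul_assoc]
      simp)
  refine ⟨c, ?_⟩
  filter_upwards [hc] with x hx
  rw [← hx, mul_assoc, ← Real.exp_add]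
  simp

theorem isWeakDeriv_toLp {J : Set ℝ} {f f' : ℝ → ℝ} (hf : MemLp f 2 (volume.restrict J))
    (hf' : MemLp f' 2 (volume.restrict J)) (hd : ∀ x, HasDerivAt f (f' x) x)
    (hc : Continuous f') : IsWeakDeriv J (hf.toLp f) (hf'.toLp f') := by
  intro φ h1 h2 h3
  have hfc : Continuous f := continuous_iff_continuousAt.2 fun x => (hd x).continuousAt
  have hφ : ∀ x, HasDerivAt φ (deriv φ x) x := fun x =>
    (h1.differentiable (by simp) x).hasDerivAt
  have hφ' : Continuous (deriv φ) := h1.continuous_deriv (by simp)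
  have z1 : ∀ x ∉ J, φ x = 0 := fun x hx =>
    image_eq_zero_of_notMem_tsupport fun h' => hx (h3 h')
  have z2 : ∀ x ∉ J, deriv φ x = 0 := fun x hx =>
    image_eq_zero_of_notMem_tsupport fun h' => hx (h3 (tsupport_deriv_subset (f := φ) h'))
  have e1 : ∫ x in J, hf.toLp f x * deriv φ x = ∫ x, f x * deriv φ x := by
    trans ∫ x in J, f x * deriv φ x
    · refine integral_congr_ae ?_
      filter_upwards [hf.coeFn_toLp] with x hx
      rw [hx]
    · exact setIntegral_eq_integral_of_forall_compl_eq_zero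
        (fun x hx => by rw [z2 x hx, mul_zero])
  have e2 : ∫ x in J, hf'.toLp f' x * φ x = ∫ x, f' x * φ x := by
    trans ∫ x in J, f' x * φ x
    · refine integral_congr_ae ?_
      filter_upwards [hf'.coeFn_toLp] with x hx
      rw [hx]
    · exact setIntegral_eq_integral_of_forall_compl_eq_zero
        (fun x hx => by rw [z1 x hx, mul_zero])
  rw [e1, e2]
  refine integral_mul_deriv_eq_deriv_mul_of_integrable (fun x _ => hd x) (fun x _ => hφ x) ?_ ?_ ?_
  · exact (hfc.mul hφ').integrable_of_hasCompactSupport h2.deriv.mul_left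
  · exact (hc.mul h1.continuous).integrable_of_hasCompactSupport h2.mul_left
  · exact (hfc.mul h1.continuous).integrable_of_hasCompactSupport h2.mul_left

/-- A class with a representative `w` continuous on `ℝ` has exactly the trace `w x`: on an open set
the continuous representative is unique. -/
theorem hasTrace_iff {J : Set ℝ} (ho : IsOpen J) {f : LTwo J} {w : ℝ → ℝ} (hw : Continuous w)
    (hf : f =ᵐ[volume.restrict J] w) {x : ℝ} (hx : x ∈ closure J) {a : ℝ} :
    HasTrace J f x a ↔ a = w x := by
  have hne : (𝓝[J] x).NeBot := mem_closure_iff_nhdsWithin_neBot.1 hx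
  have hwx : Tendsto w (𝓝[J] x) (𝓝 (w x)) := hw.continuousAt.mono_left nhdsWithin_le_nhds
  constructor
  · rintro ⟨z, hz, hfz, hza⟩
    have he : Set.EqOn z w J :=
      Measure.eqOn_open_of_ae_eq (hfz.symm.trans hf) ho hz hw.continuousOn
    refine tendsto_nhds_unique hza (hwx.congr' ?_)
    filter_upwards [self_mem_nhdsWithin] with y hy using (he hy).symm
  · rintro rfl
    exact ⟨w, hw.continuousOn, hf, hwx⟩

theorem sq_norm_eq_integral {J : Set ℝ} {f : LTwo J} {w : ℝ → ℝ}
    (hf : f =ᵐ[volume.restrict J] w) : ‖f‖ ^ 2 = ∫ x in J, w x ^ 2 := by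
  rw [← real_inner_self_eq_norm_sq, L2.inner_def]
  refine integral_congr_ae ?_
  filter_upwards [hf] with x hx
  simp [hx]

/-! ### The equation `u'' = u` on an interval -/

/-- The function `A eˣ + B e⁻ˣ`, the general solution of `u'' = u`. -/
def expFun (A B x : ℝ) : ℝ := A * Real.exp x + B * Real.exp (-x)

theorem continuous_expFun (A B : ℝ) : Continuous (expFun A B) := by
  unfold expFun; fun_prop

theorem hasDerivAt_expFun (A B x : ℝ) : HasDerivAt (expFun A B) (expFun A (-B) x) x := by
  have h := ((Real.hasDerivAt_exp x).const_mul A).add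
    (((Real.hasDerivAt_exp (-x)).comp x (hasDerivAt_neg x)).const_mul B)
  refine h.congr_deriv ?_
  simp only [expFun]; ring

/-- The element `A eˣ + B e⁻ˣ` of `H²(J)`. -/
def HTwo.ofExp {J : Set ℝ} (A B : ℝ) (h : MemLp (expFun A B) 2 (volume.restrict J))
    (h' : MemLp (expFun A (-B)) 2 (volume.restrict J)) : HTwo J where
  fn := h.toLp _
  d1 := h'.toLp _
  d2 := h.toLp _
  weak1 := isWeakDeriv_toLp h h' (hasDerivAt_expFun A B) (continuous_expFun A (-B))
  weak2 := isWeakDeriv_toLp h' h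
    (fun x => by simpa using hasDerivAt_expFun A (-B) x) (continuous_expFun A B)

theorem HTwo.ofExp_fn_ae {J : Set ℝ} {A B : ℝ} (h : MemLp (expFun A B) 2 (volume.restrict J))
    (h' : MemLp (expFun A (-B)) 2 (volume.restrict J)) :
    (HTwo.ofExp A B h h').fn =ᵐ[volume.restrict J] expFun A B := h.coeFn_toLp

theorem HTwo.ofExp_d1_ae {J : Set ℝ} {A B : ℝ} (h : MemLp (expFun A B) 2 (volume.restrict J))
    (h' : MemLp (expFun A (-B)) 2 (volume.restrict J)) :
    (HTwo.ofExp A B h h').d1 =ᵐ[volume.restrict J] expFun A (-B) := h'.coeFn_toLp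

/-- Weak solutions of `u'' = u` are classical: `u ± u'` solve first order equations. -/
theorem HTwo.exists_expFun {J : Set ℝ} (ho : IsOpen J) (hJ : J.OrdConnected) (hne : J.Nonempty)
    (u : HTwo J) (hu : u.d2 = u.fn) :
    ∃ A B : ℝ, u.fn =ᵐ[volume.restrict J] expFun A B ∧
      u.d1 =ᵐ[volume.restrict J] expFun A (-B) := by
  have hf := Lp.memLp u.fn
  have hg := Lp.memLp u.d1
  have lf := hf.locallyIntegrableOn_of_restrict
  have lg := hg.locallyIntegrableOn_of_restrict
  have hw2 := u.weak2
  rw [hu] at hw2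
  obtain ⟨a, ha⟩ := ae_eq_exp_of_weak_ode ho hJ hne (lf.add lg) 1 (by
    intro φ h1 h2 h3
    have k1 := u.weak1 φ h1 h2 h3
    have k2 := hw2 φ h1 h2 h3
    have hφ' : Continuous (deriv φ) := h1.continuous_deriv (by simp)
    have s' := (tsupport_deriv_subset (f := φ)).trans h3
    simp only [Pi.add_apply, add_mul, mul_add, one_mul]
    rw [integral_add (integrableOn_mul_test lf hφ' h2.deriv s')
      (integrableOn_mul_test lg hφ' h2.deriv s'),
      integral_add (integrableOn_mul_test lf h1.continuous h2 h3)
      (integrableOn_mul_test lg h1.continuous h2 h3), k1, k2]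
    ring)
  obtain ⟨b, hb⟩ := ae_eq_exp_of_weak_ode ho hJ hne (lf.sub lg) (-1) (by
    intro φ h1 h2 h3
    have k1 := u.weak1 φ h1 h2 h3
    have k2 := hw2 φ h1 h2 h3
    have hφ' : Continuous (deriv φ) := h1.continuous_deriv (by simp)
    have s' := (tsupport_deriv_subset (f := φ)).trans h3
    simp only [Pi.sub_apply, sub_mul, neg_sub, neg_one_mul]
    rw [integral_sub (integrableOn_mul_test lf hφ' h2.deriv s')
      (integrableOn_mul_test lg hφ' h2.deriv s'),
      integral_sub (integrableOn_mul_test lg h1.continuous h2 h3)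
      (integrableOn_mul_test lf h1.continuous h2 h3), k1, k2]
    ring)
  refine ⟨a / 2, b / 2, ?_, ?_⟩ <;>
  · filter_upwards [ha, hb] with x hx hy
    simp only [Pi.add_apply, Pi.sub_apply, one_mul, neg_one_mul] at hx hy
    simp only [expFun]
    linarith

/-- On an interval of length at least `6` the `H²` norm of a solution of `u'' = u` is controlled
by its `L²` norm.  With `P = ∫ A² e²ˣ + B² e⁻²ˣ` one has `∫ u² = P + 2ABℓ`,
`∫ u'² = P - 2ABℓ`, and `2|AB|ℓ ≤ P / 2` because `ℓ ≤ sinh ℓ / 2`. -/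
theorem integral_sq_expFun_deriv_le {ℓ : ℝ} (hℓ : 6 ≤ ℓ) (A B : ℝ) :
    ∫ x in Set.Ioo 0 ℓ, expFun A (-B) x ^ 2 ≤ 3 * ∫ x in Set.Ioo 0 ℓ, expFun A B x ^ 2 := by
  have formula : ∀ A B : ℝ, ∫ x in Set.Ioo 0 ℓ, expFun A B x ^ 2
      = Real.sinh ℓ * (A ^ 2 * Real.exp ℓ + B ^ 2 * Real.exp (-ℓ)) + 2 * A * B * ℓ := by
    intro A B
    have hd : ∀ x : ℝ, HasDerivAt (fun x => A ^ 2 * (Real.exp x) ^ 2 / 2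
        - B ^ 2 * (Real.exp (-x)) ^ 2 / 2 + 2 * A * B * x) (expFun A B x ^ 2) x := by
      intro x
      have e1 := Real.hasDerivAt_exp x
      have e2 : HasDerivAt (fun x => Real.exp (-x)) (Real.exp (-x) * -1) x :=
        (hasDerivAt_neg x).exp
      have h := ((((e1.pow 2).const_mul (A ^ 2)).div_const 2).sub
        (((e2.pow 2).const_mul (B ^ 2)).div_const 2)).add ((hasDerivAt_id x).const_mul (2 * A * B))
      refine h.congr_deriv ?_
      have : Real.exp x * Real.exp (-x) = 1 := by rw [← Real.exp_add]; simp
      simp only [expFun]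
      linear_combination (-2 * A * B) * this
    rw [← integral_Ioc_eq_integral_Ioo,
      ← intervalIntegral.integral_of_le (by linarith : (0 : ℝ) ≤ ℓ),
      intervalIntegral.integral_eq_sub_of_hasDerivAt (fun x _ => hd x)
        (((continuous_expFun A B).pow 2).intervalIntegrable _ _), Real.sinh_eq]
    have : Real.exp ℓ * Real.exp (-ℓ) = 1 := by rw [← Real.exp_add]; simp
    simp only [neg_zero, Real.exp_zero]
    linear_combination (A ^ 2 / 2 - B ^ 2 / 2) * this
  rw [formula, formula]
  have hs : 2 * ℓ ≤ Real.sinh ℓ := by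
    have h1 := Real.quadratic_le_exp_of_nonneg (by linarith : 0 ≤ ℓ)
    have h2 : Real.exp (-ℓ) ≤ 1 := Real.exp_le_one_iff.2 (by linarith)
    rw [Real.sinh_eq]
    nlinarith
  set E := Real.exp (ℓ / 2) with hE
  set E' := Real.exp (-(ℓ / 2)) with hE'
  have k1 : Real.exp ℓ = E ^ 2 := by rw [hE, ← Real.exp_nat_mul]; congr 1; push_cast; ring
  have k2 : Real.exp (-ℓ) = E' ^ 2 := by rw [hE', ← Real.exp_nat_mul]; congr 1; push_cast; ring
  have k3 : E * E' = 1 := by rw [hE, hE', ← Real.exp_add]; simp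
  rw [k1, k2]
  set P := A ^ 2 * E ^ 2 + B ^ 2 * E' ^ 2 with hP
  have hP0 : 0 ≤ P := by positivity
  have m : -(2 * (A * B)) ≤ P := by
    have : 0 ≤ (A * E + B * E') ^ 2 := sq_nonneg _
    have h5 : A * B = (A * E) * (B * E') := by linear_combination (-A * B) * k3
    rw [h5, hP]; linarith
  have m1 : -(2 * (A * B)) * ℓ ≤ P * ℓ := mul_le_mul_of_nonneg_right m (by linarith)
  have m2 : P * (2 * ℓ) ≤ P * Real.sinh ℓ := mul_le_mul_of_nonneg_left hs hP0
  rw [neg_sq]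
  nlinarith

theorem memLp_expFun_Ioo (ℓ A B : ℝ) :
    MemLp (expFun A B) 2 (volume.restrict (Set.Ioo 0 ℓ)) :=
  (memLp_two_iff_integrable_sq (continuous_expFun A B).aestronglyMeasurable).2
    ((((continuous_expFun A B).pow 2).integrableOn_Icc (a := 0) (b := ℓ)).mono_set
      Set.Ioo_subset_Icc_self)

theorem memLp_expFun_Ioi (B : ℝ) :
    MemLp (expFun 0 B) 2 (volume.restrict (Set.Ioi 0)) := by
  refine (memLp_two_iff_integrable_sq
    (continuous_expFun 0 B).aestronglyMeasurable).2 ?_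
  have h := (integrableOn_exp_mul_Ioi (a := -2) (by norm_num) 0).const_mul (B ^ 2)
  refine h.congr (Eventually.of_forall fun x => ?_)
  simp only [expFun, zero_mul, zero_add, mul_pow, ← Real.exp_nat_mul]
  congr 2; push_cast; ring

/-- The solution of `u'' = u` on `(0, ℓ)` with boundary values `a` and `b`. -/
def HTwo.interval (ℓ a b : ℝ) : HTwo (Set.Ioo 0 ℓ) :=
  HTwo.ofExp ((b - a * Real.exp (-ℓ)) / (2 * Real.sinh ℓ))
    ((a * Real.exp ℓ - b) / (2 * Real.sinh ℓ)) (memLp_expFun_Ioo _ _ _) (memLp_expFun_Ioo _ _ _)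

/-- The solution `a e⁻ˣ` of `u'' = u` on `(0, ∞)`. -/
def HTwo.halfLine (a : ℝ) : HTwo (Set.Ioi 0) :=
  HTwo.ofExp 0 a (memLp_expFun_Ioi _) (memLp_expFun_Ioi _)

theorem expFun_interval {ℓ : ℝ} (hℓ : 0 < ℓ) (a b x : ℝ) :
    expFun ((b - a * Real.exp (-ℓ)) / (2 * Real.sinh ℓ))
      ((a * Real.exp ℓ - b) / (2 * Real.sinh ℓ)) x
      = (a * Real.sinh (ℓ - x) + b * Real.sinh x) / Real.sinh ℓ := by
  have hs : Real.sinh ℓ ≠ 0 := (Real.sinh_pos_iff.2 hℓ).ne'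
  rw [expFun]
  field_simp
  rw [Real.sinh_eq (ℓ - x), Real.sinh_eq x, neg_sub, Real.exp_sub, Real.exp_sub, Real.exp_neg,
    Real.exp_neg]
  field_simp
  ring

theorem expFun_interval_deriv {ℓ : ℝ} (hℓ : 0 < ℓ) (a b x : ℝ) :
    expFun ((b - a * Real.exp (-ℓ)) / (2 * Real.sinh ℓ))
      (-((a * Real.exp ℓ - b) / (2 * Real.sinh ℓ))) x
      = (b * Real.cosh x - a * Real.cosh (ℓ - x)) / Real.sinh ℓ := by
  have hs : Real.sinh ℓ ≠ 0 := (Real.sinh_pos_iff.2 hℓ).ne'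
  rw [expFun]
  field_simp
  rw [Real.cosh_eq (ℓ - x), Real.cosh_eq x, neg_sub, Real.exp_sub, Real.exp_sub, Real.exp_neg,
    Real.exp_neg]
  field_simp
  ring

theorem HTwo.interval_fn_ae {ℓ : ℝ} (hℓ : 0 < ℓ) (a b : ℝ) :
    (HTwo.interval ℓ a b).fn =ᵐ[volume.restrict (Set.Ioo 0 ℓ)]
      fun x => (a * Real.sinh (ℓ - x) + b * Real.sinh x) / Real.sinh ℓ :=
  (HTwo.ofExp_fn_ae _ _).trans (Eventually.of_forall fun x => expFun_interval hℓ a b x)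

theorem HTwo.interval_d1_ae {ℓ : ℝ} (hℓ : 0 < ℓ) (a b : ℝ) :
    (HTwo.interval ℓ a b).d1 =ᵐ[volume.restrict (Set.Ioo 0 ℓ)]
      fun x => (b * Real.cosh x - a * Real.cosh (ℓ - x)) / Real.sinh ℓ :=
  (HTwo.ofExp_d1_ae _ _).trans (Eventually.of_forall fun x => expFun_interval_deriv hℓ a b x)

theorem HTwo.halfLine_fn_ae (a : ℝ) :
    (HTwo.halfLine a).fn =ᵐ[volume.restrict (Set.Ioi 0)] fun x => a * Real.exp (-x) :=
  (HTwo.ofExp_fn_ae _ _).trans (Eventually.of_forall fun x => by simp [expFun])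

theorem HTwo.halfLine_d1_ae (a : ℝ) :
    (HTwo.halfLine a).d1 =ᵐ[volume.restrict (Set.Ioi 0)] fun x => -a * Real.exp (-x) :=
  (HTwo.ofExp_d1_ae _ _).trans (Eventually.of_forall fun x => by simp [expFun])

theorem HTwo.eq_interval {ℓ : ℝ} (hℓ : 0 < ℓ) (u : HTwo (Set.Ioo 0 ℓ)) (hu : u.d2 = u.fn) :
    ∃ a b : ℝ, u = HTwo.interval ℓ a b := by
  obtain ⟨A, B, h1, h2⟩ := u.exists_expFun isOpen_Ioo Set.ordConnected_Ioo
    (Set.nonempty_Ioo.2 hℓ) hu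
  have hs : Real.sinh ℓ ≠ 0 := (Real.sinh_pos_iff.2 hℓ).ne'
  have hA : (expFun A B ℓ - expFun A B 0 * Real.exp (-ℓ)) / (2 * Real.sinh ℓ) = A := by
    rw [div_eq_iff (by simpa using hs), Real.sinh_eq]
    simp only [expFun, neg_zero, Real.exp_zero]
    ring
  have hB : (expFun A B 0 * Real.exp ℓ - expFun A B ℓ) / (2 * Real.sinh ℓ) = B := by
    rw [div_eq_iff (by simpa using hs), Real.sinh_eq]
    simp only [expFun, neg_zero, Real.exp_zero]
    ring
  have e1 : u.fn = (HTwo.interval ℓ (expFun A B 0) (expFun A B ℓ)).fn := by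
    refine Lp.ext (h1.trans ?_)
    refine EventuallyEq.trans ?_ (HTwo.ofExp_fn_ae _ _).symm
    rw [hA, hB]
  have e2 : u.d1 = (HTwo.interval ℓ (expFun A B 0) (expFun A B ℓ)).d1 := by
    refine Lp.ext (h2.trans ?_)
    refine EventuallyEq.trans ?_ (HTwo.ofExp_d1_ae _ _).symm
    rw [hA, hB]
  exact ⟨_, _, HTwo.ext e1 e2 (hu.trans e1)⟩

/-- On a half-line the growing exponential is excluded because `u + u'` is square integrable. -/
theorem HTwo.eq_halfLine (u : HTwo (Set.Ioi 0)) (hu : u.d2 = u.fn) :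
    ∃ a : ℝ, u = HTwo.halfLine a := by
  obtain ⟨A, B, h1, h2⟩ := u.exists_expFun isOpen_Ioi Set.ordConnected_Ioi Set.nonempty_Ioi hu
  have hA : A = 0 := by
    by_contra hA
    have h3 : MemLp (fun x => 2 * A * Real.exp x) 2 (volume.restrict (Set.Ioi (0 : ℝ))) := by
      refine ((Lp.memLp u.fn).add (Lp.memLp u.d1)).ae_eq ?_
      filter_upwards [h1, h2] with x hx hy
      simp only [Pi.add_apply, hx, hy, expFun]; ring
    have h4 := h3.integrable_sq.const_mul ((2 * A) ^ 2)⁻¹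
    have h5 : IntegrableOn (fun _ : ℝ => (1 : ℝ)) (Set.Ioi 0) := by
      refine h4.mono' aestronglyMeasurable_const ?_
      filter_upwards [ae_restrict_mem measurableSet_Ioi] with x hx
      rw [mul_pow (2 * A), inv_mul_cancel_left₀ (by positivity), norm_one]
      exact one_le_pow₀ (Real.one_le_exp (le_of_lt hx))
    simp [integrableOn_const_iff] at h5
  subst hA
  have e1 : u.fn = (HTwo.halfLine B).fn := Lp.ext (h1.trans (HTwo.ofExp_fn_ae _ _).symm)
  have e2 : u.d1 = (HTwo.halfLine B).d1 := Lp.ext (h2.trans (HTwo.ofExp_d1_ae _ _).symm)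
  exact ⟨B, HTwo.ext e1 e2 (hu.trans e1)⟩

theorem sinh_sub_le {ℓ x : ℝ} (hx : 0 ≤ x) :
    Real.sinh (ℓ - x) ≤ Real.exp (-x) * Real.sinh ℓ := by
  have h : Real.exp (-ℓ - x) ≤ Real.exp (-ℓ + x) := Real.exp_le_exp.2 (by linarith)
  rw [Real.sinh_eq, Real.sinh_eq, neg_sub]
  have h1 : Real.exp (-x) * Real.exp ℓ = Real.exp (ℓ - x) := by rw [← Real.exp_add]; congr 1; ring
  have h2 : Real.exp (-x) * Real.exp (-ℓ) = Real.exp (-ℓ - x) := by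
    rw [← Real.exp_add]; congr 1; ring
  have h3 : Real.exp (x - ℓ) = Real.exp (-ℓ + x) := by congr 1; ring
  rw [mul_div_assoc', mul_sub, h1, h2, h3]
  linarith

/-- The bound is uniform in the length of the interval, since
`sinh (ℓ - x) / sinh ℓ ≤ e⁻ˣ`. -/
theorem HTwo.sq_norm_interval_le {ℓ : ℝ} (hℓ : 0 < ℓ) (a b : ℝ) :
    ‖(HTwo.interval ℓ a b).fn‖ ^ 2 ≤ a ^ 2 + b ^ 2 := by
  have hs : 0 < Real.sinh ℓ := Real.sinh_pos_iff.2 hℓ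
  rw [sq_norm_eq_integral (HTwo.interval_fn_ae hℓ a b)]
  have hcont : Continuous fun x : ℝ =>
      2 * (a ^ 2 * Real.exp (-x) ^ 2 + b ^ 2 * Real.exp (x - ℓ) ^ 2) := by fun_prop
  have hcont' : Continuous fun x : ℝ =>
      ((a * Real.sinh (ℓ - x) + b * Real.sinh x) / Real.sinh ℓ) ^ 2 := by fun_prop
  have hle : ∫ x in Set.Ioo 0 ℓ, ((a * Real.sinh (ℓ - x) + b * Real.sinh x) / Real.sinh ℓ) ^ 2
      ≤ ∫ x in Set.Ioo 0 ℓ, 2 * (a ^ 2 * Real.exp (-x) ^ 2 + b ^ 2 * Real.exp (x - ℓ) ^ 2) := by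
    refine setIntegral_mono_on
      ((hcont'.integrableOn_Icc (a := 0) (b := ℓ)).mono_set Set.Ioo_subset_Icc_self)
      ((hcont.integrableOn_Icc (a := 0) (b := ℓ)).mono_set Set.Ioo_subset_Icc_self)
      measurableSet_Ioo fun x hx => ?_
    have p1 : 0 ≤ Real.sinh (ℓ - x) := (Real.sinh_pos_iff.2 (by linarith [hx.2])).le
    have p2 : 0 ≤ Real.sinh x := (Real.sinh_pos_iff.2 hx.1).le
    have q1 : Real.sinh (ℓ - x) / Real.sinh ℓ ≤ Real.exp (-x) :=
      (div_le_iff₀ hs).2 (sinh_sub_le hx.1.le)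
    have q2 : Real.sinh x / Real.sinh ℓ ≤ Real.exp (x - ℓ) := by
      have := sinh_sub_le (ℓ := ℓ) (x := ℓ - x) (by linarith [hx.2])
      rw [sub_sub_cancel, neg_sub] at this
      exact (div_le_iff₀ hs).2 this
    have r1 : (Real.sinh (ℓ - x) / Real.sinh ℓ) ^ 2 ≤ Real.exp (-x) ^ 2 :=
      pow_le_pow_left₀ (div_nonneg p1 hs.le) q1 2
    have r2 : (Real.sinh x / Real.sinh ℓ) ^ 2 ≤ Real.exp (x - ℓ) ^ 2 :=
      pow_le_pow_left₀ (div_nonneg p2 hs.le) q2 2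
    rw [add_div, mul_div_assoc, mul_div_assoc]
    refine add_sq_le.trans ?_
    rw [mul_pow, mul_pow]
    gcongr
  refine hle.trans ?_
  have hd : ∀ x : ℝ, HasDerivAt (fun x => -a ^ 2 * Real.exp (-x) ^ 2
      + b ^ 2 * Real.exp (x - ℓ) ^ 2)
      (2 * (a ^ 2 * Real.exp (-x) ^ 2 + b ^ 2 * Real.exp (x - ℓ) ^ 2)) x := by
    intro x
    have e1 : HasDerivAt (fun x => Real.exp (-x)) (Real.exp (-x) * -1) x :=
      (hasDerivAt_neg x).exp
    have e2 : HasDerivAt (fun x => Real.exp (x - ℓ)) (Real.exp (x - ℓ) * 1) x :=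
      ((hasDerivAt_id x).sub_const ℓ).exp
    have h := ((e1.pow 2).const_mul (-a ^ 2)).add ((e2.pow 2).const_mul (b ^ 2))
    refine h.congr_deriv ?_
    ring
  rw [← integral_Ioc_eq_integral_Ioo, ← intervalIntegral.integral_of_le hℓ.le,
    intervalIntegral.integral_eq_sub_of_hasDerivAt (fun x _ => hd x)
      (hcont.intervalIntegrable _ _)]
  simp only [sub_self, neg_zero, Real.exp_zero]
  have := mul_nonneg (sq_nonneg a) (sq_nonneg (Real.exp (-ℓ)))
  have := mul_nonneg (sq_nonneg b) (sq_nonneg (Real.exp (0 - ℓ)))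
  linarith

theorem HTwo.sq_norm_halfLine_le (a : ℝ) : ‖(HTwo.halfLine a).fn‖ ^ 2 ≤ a ^ 2 := by
  rw [sq_norm_eq_integral (HTwo.halfLine_fn_ae a)]
  have : ∀ x : ℝ, (a * Real.exp (-x)) ^ 2 = a ^ 2 * Real.exp (-2 * x) := by
    intro x; rw [mul_pow, ← Real.exp_nat_mul]; congr 2; push_cast; ring
  simp_rw [this]
  rw [integral_const_mul, integral_exp_mul_Ioi (by norm_num)]
  simp only [mul_zero, Real.exp_zero]
  nlinarith [sq_nonneg a]

theorem HTwo.sq_norm_d1_le_of_Ioo {ℓ : ℝ} (hℓ : 6 ≤ ℓ) (u : HTwo (Set.Ioo 0 ℓ))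
    (hu : u.d2 = u.fn) : ‖u.d1‖ ^ 2 ≤ 3 * ‖u.fn‖ ^ 2 := by
  obtain ⟨A, B, h1, h2⟩ := u.exists_expFun isOpen_Ioo Set.ordConnected_Ioo
    (Set.nonempty_Ioo.2 (by linarith)) hu
  rw [sq_norm_eq_integral h1, sq_norm_eq_integral h2]
  exact integral_sq_expFun_deriv_le hℓ A B

theorem HTwo.sq_norm_d1_of_Ioi (u : HTwo (Set.Ioi 0)) (hu : u.d2 = u.fn) :
    ‖u.d1‖ ^ 2 = ‖u.fn‖ ^ 2 := by
  obtain ⟨a, rfl⟩ := u.eq_halfLine hu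
  rw [sq_norm_eq_integral (HTwo.halfLine_fn_ae a), sq_norm_eq_integral (HTwo.halfLine_d1_ae a)]
  congr 1; ext x; ring

/-! ### Solutions of the equation on a metric graph -/

namespace MetricGraph

variable {V F I : Type*}

/-- The function on the graph that solves `u'' = u` on every edge and has the value `y s` at every
edge end `s`. -/
def ofEndValues (G : MetricGraph V F I) (y : (F ⊕ I) ⊕ F → ℝ) : G.Sobolev
  | Sum.inl e => HTwo.interval (G.len e) (y (Sum.inl (Sum.inl e))) (y (Sum.inr e))
  | Sum.inr i => HTwo.halfLine (y (Sum.inl (Sum.inr i)))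

/-- The edge end at the other end of the same edge; the only end of a half-line is sent to
itself. -/
def otherEnd : (F ⊕ I) ⊕ F → (F ⊕ I) ⊕ F
  | Sum.inl (Sum.inl e) => Sum.inr e
  | Sum.inl (Sum.inr i) => Sum.inl (Sum.inr i)
  | Sum.inr e => Sum.inl (Sum.inl e)

/-- The coefficient `coth ℓ` of the value at an edge end in the outward derivative there; a
half-line has `coth ∞ = 1`. -/
def endCoth (G : MetricGraph V F I) : (F ⊕ I) ⊕ F → ℝ
  | Sum.inl (Sum.inl e) => Real.cosh (G.len e) / Real.sinh (G.len e)
  | Sum.inl (Sum.inr _) => 1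
  | Sum.inr e => Real.cosh (G.len e) / Real.sinh (G.len e)

/-- The coefficient `1 / sinh ℓ` of the value at the other end in the outward derivative at an
edge end; a half-line has `1 / sinh ∞ = 0`. -/
def endCsch (G : MetricGraph V F I) : (F ⊕ I) ⊕ F → ℝ
  | Sum.inl (Sum.inl e) => 1 / Real.sinh (G.len e)
  | Sum.inl (Sum.inr _) => 0
  | Sum.inr e => 1 / Real.sinh (G.len e)

/-- The outward derivative of `ofEndValues y` at an edge end. -/
def outward (G : MetricGraph V F I) (y : (F ⊕ I) ⊕ F → ℝ) (s : (F ⊕ I) ⊕ F) : ℝ :=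
  G.endCoth s * y s - G.endCsch s * y (otherEnd s)

theorem isOpen_dom (G : MetricGraph V F I) : ∀ e, IsOpen (G.dom e)
  | Sum.inl _ => isOpen_Ioo
  | Sum.inr _ => isOpen_Ioi

theorem zero_mem_closure_dom (G : MetricGraph V F I) : ∀ e, (0 : ℝ) ∈ closure (G.dom e)
  | Sum.inl e => by
      rw [dom, closure_Ioo (G.len_pos e).ne]
      exact Set.left_mem_Icc.2 (G.len_pos e).le
  | Sum.inr _ => by
      rw [dom, closure_Ioi]
      exact Set.mem_Ici.2 le_rfl

theorem len_mem_closure_dom (G : MetricGraph V F I) (e : F) :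
    G.len e ∈ closure (G.dom (Sum.inl e)) := by
  rw [dom, closure_Ioo (G.len_pos e).ne]
  exact Set.right_mem_Icc.2 (G.len_pos e).le

theorem hasValue_ofEndValues (G : MetricGraph V F I) (y : (F ⊕ I) ⊕ F → ℝ) (s : (F ⊕ I) ⊕ F)
    (a : ℝ) : G.HasValue (G.ofEndValues y) s a ↔ a = y s := by
  have hs : ∀ e, Real.sinh (G.len e) ≠ 0 := fun e => (Real.sinh_pos_iff.2 (G.len_pos e)).ne'
  rcases s with (e | i) | e
  · refine (hasTrace_iff (G.isOpen_dom (Sum.inl e)) (by fun_prop)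
      (HTwo.interval_fn_ae (G.len_pos e) _ _) (G.zero_mem_closure_dom (Sum.inl e))).trans ?_
    simp [hs e]
  · refine (hasTrace_iff (G.isOpen_dom (Sum.inr i)) (by fun_prop)
      (HTwo.halfLine_fn_ae _) (G.zero_mem_closure_dom (Sum.inr i))).trans ?_
    simp
  · refine (hasTrace_iff (G.isOpen_dom (Sum.inl e)) (by fun_prop)
      (HTwo.interval_fn_ae (G.len_pos e) _ _) (G.len_mem_closure_dom e)).trans ?_
    simp [hs e]

theorem hasOutwardDeriv_ofEndValues (G : MetricGraph V F I) (y : (F ⊕ I) ⊕ F → ℝ)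
    (s : (F ⊕ I) ⊕ F) (q : ℝ) :
    G.HasOutwardDeriv (G.ofEndValues y) s q ↔ q = G.outward y s := by
  rcases s with (e | i) | e
  · refine (hasTrace_iff (G.isOpen_dom (Sum.inl e)) (by fun_prop)
      (HTwo.interval_d1_ae (G.len_pos e) _ _) (G.zero_mem_closure_dom (Sum.inl e))).trans ?_
    rw [neg_eq_iff_eq_neg]
    simp only [outward, endCoth, endCsch, otherEnd, Real.cosh_zero, sub_zero]
    ring_nf
  · refine (hasTrace_iff (G.isOpen_dom (Sum.inr i)) (by fun_prop)
      (HTwo.halfLine_d1_ae _) (G.zero_mem_closure_dom (Sum.inr i))).trans ?_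
    simp [outward, endCoth, endCsch]
  · refine (hasTrace_iff (G.isOpen_dom (Sum.inl e)) (by fun_prop)
      (HTwo.interval_d1_ae (G.len_pos e) _ _) (G.len_mem_closure_dom e)).trans ?_
    simp only [outward, endCoth, endCsch, otherEnd, Real.cosh_zero, sub_self]
    ring_nf

theorem ofEndValues_d2 (G : MetricGraph V F I) (y : (F ⊕ I) ⊕ F → ℝ) :
    ∀ e, (G.ofEndValues y e).d2 = (G.ofEndValues y e).fn
  | Sum.inl _ => rfl
  | Sum.inr _ => rfl

theorem exists_eq_ofEndValues (G : MetricGraph V F I) (u : G.Sobolev)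
    (hu : ∀ e, (u e).d2 = (u e).fn) : ∃ y, u = G.ofEndValues y := by
  have h1 : ∀ e : F, ∃ a b : ℝ, u (Sum.inl e) = HTwo.interval (G.len e) a b := fun e =>
    HTwo.eq_interval (G.len_pos e) _ (hu (Sum.inl e))
  have h2 : ∀ i : I, ∃ a : ℝ, u (Sum.inr i) = HTwo.halfLine a := fun i =>
    HTwo.eq_halfLine _ (hu (Sum.inr i))
  choose a b h1 using h1
  choose c h2 using h2
  refine ⟨Sum.elim (Sum.elim a c) b, funext fun e => ?_⟩
  rcases e with e | i
  · exact h1 e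
  · exact h2 i

theorem endCsch_nonneg (G : MetricGraph V F I) (s : (F ⊕ I) ⊕ F) : 0 ≤ G.endCsch s := by
  rcases s with (e | i) | e
  · exact one_div_nonneg.2 (Real.sinh_pos_iff.2 (G.len_pos e)).le
  · exact le_rfl
  · exact one_div_nonneg.2 (Real.sinh_pos_iff.2 (G.len_pos e)).le

theorem endCsch_lt_endCoth (G : MetricGraph V F I) (s : (F ⊕ I) ⊕ F) :
    G.endCsch s < G.endCoth s := by
  have h : ∀ e, 1 / Real.sinh (G.len e) < Real.cosh (G.len e) / Real.sinh (G.len e) := fun e =>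
    div_lt_div_of_pos_right (Real.one_lt_cosh.2 (G.len_pos e).ne')
      (Real.sinh_pos_iff.2 (G.len_pos e))
  rcases s with (e | i) | e
  · exact h e
  · exact zero_lt_one
  · exact h e

/-- For `t ≥ 1` both `coth t - 1` and `1 / sinh t` are of the order `e⁻ᵗ`. -/
theorem coth_csch_bounds {t : ℝ} (ht : 1 ≤ t) :
    |Real.cosh t / Real.sinh t - 1| ≤ Real.exp (-t) ∧ 1 / Real.sinh t ≤ 4 * Real.exp (-t) := by
  have h1 : 1 ≤ Real.sinh t := ht.trans (Real.self_le_sinh_iff.2 (by linarith))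
  have h2 : 2 ≤ Real.exp t := by linarith [Real.add_one_le_exp t]
  have h3 : Real.exp t * Real.exp (-t) = 1 := by rw [← Real.exp_add]; simp
  have h4 := Real.exp_pos (-t)
  constructor
  · rw [div_sub_one (by positivity), Real.cosh_sub_sinh, abs_of_nonneg (by positivity)]
    exact div_le_self h4.le h1
  · rw [div_le_iff₀ (by positivity), Real.sinh_eq]
    nlinarith

theorem abs_endCoth_sub_one_le (G : MetricGraph V F I) {ε : ℝ} (hε : 0 ≤ ε)
    (h1 : ∀ e, 1 ≤ G.len e) (h2 : ∀ e, Real.exp (-G.len e) ≤ ε) (s : (F ⊕ I) ⊕ F) :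
    |G.endCoth s - 1| ≤ ε := by
  rcases s with (e | i) | e
  · exact (coth_csch_bounds (h1 e)).1.trans (h2 e)
  · simpa [endCoth] using hε
  · exact (coth_csch_bounds (h1 e)).1.trans (h2 e)

theorem endCsch_le (G : MetricGraph V F I) {ε : ℝ} (hε : 0 ≤ ε)
    (h1 : ∀ e, 1 ≤ G.len e) (h2 : ∀ e, Real.exp (-G.len e) ≤ ε) (s : (F ⊕ I) ⊕ F) :
    G.endCsch s ≤ 4 * ε := by
  have h : ∀ e, 1 / Real.sinh (G.len e) ≤ 4 * ε := fun e => by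
    linarith [(coth_csch_bounds (h1 e)).2, h2 e]
  rcases s with (e | i) | e
  · exact h e
  · simpa [endCsch] using hε
  · exact h e

/-! ### Edge lengths and norms -/

theorem expDecay_nonneg (G : MetricGraph V F I) (μ : ℝ) : 0 ≤ G.expDecay μ := by
  unfold expDecay
  split_ifs
  · exact (Real.exp_pos _).le
  · exact le_rfl

theorem exp_neg_le_expDecay [Finite F] (G : MetricGraph V F I) {μ : ℝ} (hμ : 0 ≤ μ) (e : F) :
    Real.exp (-(μ * G.len e)) ≤ G.expDecay μ := by
  have : Nonempty F := ⟨e⟩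
  rw [expDecay, if_pos this, Real.exp_le_exp, neg_le_neg_iff]
  exact mul_le_mul_of_nonneg_left (ciInf_le (Set.finite_range _).bddBelow e) hμ

theorem eventually_le_scale_len [Finite F] (G : MetricGraph V F I) (c : ℝ) :
    ∀ᶠ μ in atTop, ∀ e, c ≤ μ * G.len e :=
  eventually_all.2 fun e =>
    (tendsto_id.atTop_mul_const (G.len_pos e)).eventually_ge_atTop c

theorem sqNormH2_le [Fintype F] [Fintype I] (G : MetricGraph V F I)
    (hlen : ∀ e, 6 ≤ G.len e) (u : G.Sobolev) (hu : ∀ e, (u e).d2 = (u e).fn) :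
    G.sqNormH2 u ≤ 5 * G.sqNormL2 u := by
  rw [sqNormH2, sqNormL2, Finset.mul_sum]
  refine Finset.sum_le_sum fun e _ => ?_
  have h : ‖(u e).d1‖ ^ 2 ≤ 3 * ‖(u e).fn‖ ^ 2 := by
    rcases e with e | i
    · exact HTwo.sq_norm_d1_le_of_Ioo (hlen e) _ (hu (Sum.inl e))
    · have := HTwo.sq_norm_d1_of_Ioi _ (hu (Sum.inr i))
      change ‖(u (Sum.inr i)).d1‖ ^ 2 = ‖(u (Sum.inr i)).fn‖ ^ 2 at this
      rw [this]
      linarith [sq_nonneg ‖(u (Sum.inr i)).fn‖]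
  rw [hu e]
  linarith

theorem sqNormL2_le_sqNormH2 [Fintype F] [Fintype I] (G : MetricGraph V F I) (u : G.Sobolev) :
    G.sqNormL2 u ≤ G.sqNormH2 u :=
  Finset.sum_le_sum fun e _ => by
    have h1 := sq_nonneg ‖(u e).d1‖
    have h2 := sq_nonneg ‖(u e).d2‖
    linarith

/-! ### Reduction to the values at the vertices -/

variable [Fintype F] [Fintype I] [DecidableEq V]

/-- The map from the values at the vertices to the sums of the outward derivatives at the
vertices. -/
def flux (G : MetricGraph V F I) : (V → ℝ) →ₗ[ℝ] (V → ℝ) where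
  toFun x v := ∑ s with G.endVertex s = v, G.outward (x ∘ G.endVertex) s
  map_add' x y := by
    ext v
    simp only [Pi.add_apply, ← Finset.sum_add_distrib]
    refine Finset.sum_congr rfl fun s _ => ?_
    simp only [outward, Function.comp_apply, Pi.add_apply]; ring
  map_smul' c x := by
    ext v
    simp only [Pi.smul_apply, smul_eq_mul, Finset.mul_sum, RingHom.id_apply]
    refine Finset.sum_congr rfl fun s _ => ?_
    simp only [outward, Function.comp_apply, Pi.smul_apply, smul_eq_mul]; ring

theorem flux_apply (G : MetricGraph V F I) (x : V → ℝ) (v : V) :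
    G.flux x v = ∑ s with G.endVertex s = v,
      (G.endCoth s * x v - G.endCsch s * x (G.endVertex (otherEnd s))) := by
  refine Finset.sum_congr rfl fun s hs => ?_
  simp only [outward, Function.comp_apply, (Finset.mem_filter.1 hs).2]

theorem hasNeumannData_iff (G : MetricGraph V F I) (x : V → ℝ) (v : V) (q : ℝ) :
    G.HasNeumannData (G.ofEndValues (x ∘ G.endVertex)) v q ↔ q = G.flux x v := by
  constructor
  · rintro ⟨d, hd, rfl⟩
    refine Finset.sum_congr rfl fun s hs => ?_
    exact (G.hasOutwardDeriv_ofEndValues _ _ _).1 (hd s (Finset.mem_filter.1 hs).2)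
  · rintro rfl
    exact ⟨_, fun s _ => (G.hasOutwardDeriv_ofEndValues _ _ _).2 rfl, rfl⟩

theorem degree_eq_zero_iff (G : MetricGraph V F I) (v : V) :
    G.degree v = 0 ↔ ∀ s, G.endVertex s ≠ v := by
  rw [degree, Finset.card_eq_zero, Finset.filter_eq_empty_iff]
  simp

/-- The linear operator of the boundary value problem on vertex values: the value at the vertices
of `B`, the sum of outward derivatives elsewhere.  An isolated vertex outside `B` imposes no
condition on `u`; its value is normalized as well to make the operator invertible. -/
def vertexOp (G : MetricGraph V F I) (B : Finset V) : (V → ℝ) →ₗ[ℝ] (V → ℝ) where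
  toFun x v := if v ∈ B ∨ G.degree v = 0 then x v else G.flux x v
  map_add' x y := by
    ext v
    simp only [map_add, Pi.add_apply]
    split_ifs <;> rfl
  map_smul' c x := by
    ext v
    simp only [map_smul, Pi.smul_apply, RingHom.id_apply]
    split_ifs <;> rfl

/-- The maximum principle: `coth ℓ > 1 / sinh ℓ` makes the vertex equations strictly diagonally
dominant, so `|x|` cannot have a nonzero maximum at a vertex where the Kirchhoff condition
holds. -/
theorem abs_le_of_flux_eq_zero [Finite V] (G : MetricGraph V F I) (B : Finset V) {x : V → ℝ}
    {P : ℝ} (hP : 0 ≤ P) (h : ∀ v, v ∈ B ∨ G.degree v = 0 → |x v| ≤ P)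
    (h' : ∀ v, ¬(v ∈ B ∨ G.degree v = 0) → G.flux x v = 0) (v : V) : |x v| ≤ P := by
  have : Nonempty V := ⟨v⟩
  obtain ⟨w, hw⟩ := Finite.exists_max fun v => |x v|
  refine (hw v).trans ?_
  by_cases hB : w ∈ B ∨ G.degree w = 0
  · exact h w hB
  have hf := h' w hB
  by_contra! hlt
  have hpos : 0 < |x w| := hP.trans_lt hlt
  have hne : (Finset.univ.filter fun s => G.endVertex s = w).Nonempty :=
    Finset.card_pos.1 (Nat.pos_of_ne_zero (not_or.1 hB).2)
  rw [flux_apply, Finset.sum_sub_distrib, ← Finset.sum_mul, sub_eq_zero] at hf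
  have hκ : 0 ≤ ∑ s with G.endVertex s = w, G.endCoth s := Finset.sum_nonneg fun s _ =>
    (G.endCsch_nonneg s).trans (G.endCsch_lt_endCoth s).le
  have h1 : (∑ s with G.endVertex s = w, G.endCoth s) * |x w|
      ≤ ∑ s with G.endVertex s = w, G.endCsch s * |x w| := by
    rw [← abs_of_nonneg hκ, ← abs_mul, hf]
    refine (Finset.abs_sum_le_sum_abs _ _).trans (Finset.sum_le_sum fun s _ => ?_)
    rw [abs_mul, abs_of_nonneg (G.endCsch_nonneg s)]
    exact mul_le_mul_of_nonneg_left (hw _) (G.endCsch_nonneg s)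
  rw [Finset.sum_mul] at h1
  exact absurd h1 (not_le.2 (Finset.sum_lt_sum_of_nonempty hne fun s _ =>
    mul_lt_mul_of_pos_right (G.endCsch_lt_endCoth s) hpos))

theorem vertexOp_injective [Finite V] (G : MetricGraph V F I) (B : Finset V) :
    Function.Injective (G.vertexOp B) := by
  rw [injective_iff_map_eq_zero]
  intro x hx
  have hv : ∀ v, (if v ∈ B ∨ G.degree v = 0 then x v else G.flux x v) = 0 := fun v =>
    congrFun hx v
  ext v
  refine abs_nonpos_iff.1 (G.abs_le_of_flux_eq_zero B le_rfl (fun v h => ?_) (fun v h => ?_) v)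
  · have := hv v
    rw [if_pos h] at this
    simp [this]
  · have := hv v
    rwa [if_neg h] at this

/-- The extension of Dirichlet data by zero to all vertices. -/
def extendData (B : Finset V) : EuclideanSpace ℝ B →ₗ[ℝ] (V → ℝ) where
  toFun p v := if h : v ∈ B then p ⟨v, h⟩ else 0
  map_add' p q := by
    ext v
    simp only [Pi.add_apply, PiLp.add_apply]
    split_ifs <;> simp
  map_smul' c p := by
    ext v
    simp only [Pi.smul_apply, PiLp.smul_apply, RingHom.id_apply]
    split_ifs <;> simp

/-- The vertex values of the solution with Dirichlet data `p`. -/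
def vertexValues [Finite V] (G : MetricGraph V F I) (B : Finset V) :
    EuclideanSpace ℝ B →ₗ[ℝ] (V → ℝ) :=
  (LinearEquiv.ofInjectiveEndo (G.vertexOp B) (G.vertexOp_injective B)).symm.toLinearMap ∘ₗ
    extendData B

theorem vertexOp_vertexValues [Finite V] (G : MetricGraph V F I) (B : Finset V)
    (p : EuclideanSpace ℝ B) : G.vertexOp B (G.vertexValues B p) = extendData B p :=
  (LinearEquiv.ofInjectiveEndo (G.vertexOp B) (G.vertexOp_injective B)).apply_symm_apply _

theorem eq_vertexValues [Finite V] (G : MetricGraph V F I) (B : Finset V)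
    {p : EuclideanSpace ℝ B} {x : V → ℝ} (h : G.vertexOp B x = extendData B p) :
    x = G.vertexValues B p :=
  G.vertexOp_injective B (h.trans (G.vertexOp_vertexValues B p).symm)

theorem vertexValues_of_mem [Finite V] (G : MetricGraph V F I) (B : Finset V)
    (p : EuclideanSpace ℝ B) (v : B) : G.vertexValues B p v = p v := by
  have h := congrFun (G.vertexOp_vertexValues B p) v
  simpa [vertexOp, extendData] using h

theorem vertexValues_of_degree_eq_zero [Finite V] (G : MetricGraph V F I) (B : Finset V)
    (p : EuclideanSpace ℝ B) {v : V} (hv : v ∉ B) (hd : G.degree v = 0) :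
    G.vertexValues B p v = 0 := by
  have h := congrFun (G.vertexOp_vertexValues B p) v
  simpa [vertexOp, extendData, hv, hd] using h

theorem flux_vertexValues [Finite V] (G : MetricGraph V F I) (B : Finset V)
    (p : EuclideanSpace ℝ B) {v : V} (hv : v ∉ B) : G.flux (G.vertexValues B p) v = 0 := by
  by_cases hd : G.degree v = 0
  · have : (Finset.univ.filter fun s => G.endVertex s = v) = ∅ := Finset.card_eq_zero.1 hd
    rw [flux_apply, this, Finset.sum_empty]
  · have h := congrFun (G.vertexOp_vertexValues B p) v
    simpa [vertexOp, extendData, hv, hd] using h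

theorem abs_vertexValues_le [Finite V] (G : MetricGraph V F I) (B : Finset V)
    (p : EuclideanSpace ℝ B) (v : V) : |G.vertexValues B p v| ≤ ‖p‖ := by
  refine G.abs_le_of_flux_eq_zero B (norm_nonneg p) (fun v h => ?_) (fun v h => ?_) v
  · by_cases hv : v ∈ B
    · rw [G.vertexValues_of_mem B p ⟨v, hv⟩]
      exact PiLp.norm_apply_le p _
    · rw [G.vertexValues_of_degree_eq_zero B p hv (h.resolve_left hv), abs_zero]
      exact norm_nonneg p
  · exact G.flux_vertexValues B p (not_or.1 h).1

/-- The solution of the boundary value problem with Dirichlet data `p`. -/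
def solution [Finite V] (G : MetricGraph V F I) (B : Finset V) (p : EuclideanSpace ℝ B) :
    G.Sobolev :=
  G.ofEndValues (G.vertexValues B p ∘ G.endVertex)

theorem isSolution_solution [Finite V] (G : MetricGraph V F I) (B : Finset V)
    (p : EuclideanSpace ℝ B) : G.IsSolution B p (G.solution B p) where
  eqn e := by rw [solution, ofEndValues_d2, neg_add_cancel]
  kirchhoff v hv := by
    refine ⟨⟨G.vertexValues B p v, fun s hs => ?_⟩, ?_⟩
    · exact (G.hasValue_ofEndValues _ _ _).2 (by rw [Function.comp_apply, hs])
    · exact (G.hasNeumannData_iff _ _ _).2 (G.flux_vertexValues B p hv).symm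
  dirichlet v s hs :=
    (G.hasValue_ofEndValues _ _ _).2 (by rw [Function.comp_apply, hs, vertexValues_of_mem])

theorem isSolution_iff [Finite V] (G : MetricGraph V F I) (B : Finset V)
    (p : EuclideanSpace ℝ B) (u : G.Sobolev) : G.IsSolution B p u ↔ u = G.solution B p := by
  classical
  refine ⟨fun hu => ?_, fun h => h ▸ G.isSolution_solution B p⟩
  obtain ⟨y, rfl⟩ := G.exists_eq_ofEndValues u fun e => by
    have := hu.eqn e
    rw [neg_add_eq_zero] at this
    exact this
  let x : V → ℝ := fun v => if hB : v ∈ B then p ⟨v, hB⟩ else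
    if h : ∃ s, G.endVertex s = v then y h.choose else 0
  have hxy : y = x ∘ G.endVertex := by
    ext s
    simp only [x, Function.comp_apply]
    split_ifs with hB h
    · exact ((G.hasValue_ofEndValues _ _ _).1 (hu.dirichlet ⟨_, hB⟩ s rfl)).symm
    · obtain ⟨⟨a, ha⟩, -⟩ := hu.kirchhoff _ hB
      rw [← (G.hasValue_ofEndValues _ _ _).1 (ha s rfl),
        ← (G.hasValue_ofEndValues _ _ _).1 (ha h.choose h.choose_spec)]
    · exact absurd ⟨s, rfl⟩ h
  have hx : x = G.vertexValues B p := by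
    refine G.eq_vertexValues B (funext fun v => ?_)
    change (if v ∈ B ∨ G.degree v = 0 then x v else G.flux x v)
      = if hB : v ∈ B then p ⟨v, hB⟩ else 0
    by_cases hB : v ∈ B
    · simp [hB, x]
    · by_cases hd : G.degree v = 0
      · have h : ¬∃ s, G.endVertex s = v := fun ⟨s, hs⟩ => (G.degree_eq_zero_iff v).1 hd s hs
        simp only [hB, hd, or_true, if_true, dif_neg, not_false_eq_true, x, h]
      · have h := (hu.kirchhoff v hB).2
        rw [hxy] at h
        simpa [hB, hd] using ((G.hasNeumannData_iff _ _ _).1 h).symm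
  rw [solution, ← hx, ← hxy]

/-! ### The `L²` bound and the Dirichlet-to-Neumann map -/

theorem sqNormL2_solution_le [Finite V] (G : MetricGraph V F I) (B : Finset V)
    (p : EuclideanSpace ℝ B) :
    G.sqNormL2 (G.solution B p) ≤ Fintype.card (F ⊕ I) * 2 * ‖p‖ ^ 2 := by
  have hx : ∀ v, G.vertexValues B p v ^ 2 ≤ ‖p‖ ^ 2 := fun v => by
    rw [← sq_abs]
    exact pow_le_pow_left₀ (abs_nonneg _) (G.abs_vertexValues_le B p v) 2
  rw [mul_assoc, ← nsmul_eq_mul]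
  refine Finset.sum_le_card_nsmul _ _ _ fun e _ => ?_
  rcases e with e | i
  · refine (HTwo.sq_norm_interval_le (G.len_pos e) _ _).trans ?_
    have h1 := hx (G.init (Sum.inl e))
    have h2 := hx (G.term e)
    simp only [Function.comp_apply, endVertex, Sum.elim_inl, Sum.elim_inr]
    linarith
  · refine (HTwo.sq_norm_halfLine_le _).trans ?_
    have h1 := hx (G.init (Sum.inr i))
    simp only [Function.comp_apply, endVertex, Sum.elim_inl]
    nlinarith [sq_nonneg ‖p‖]

/-- The Dirichlet-to-Neumann map. -/
def dtn [Finite V] (G : MetricGraph V F I) (B : Finset V) :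
    EuclideanSpace ℝ B →L[ℝ] EuclideanSpace ℝ B :=
  LinearMap.toContinuousLinearMap
    ((WithLp.linearEquiv 2 ℝ (B → ℝ)).symm.toLinearMap ∘ₗ
      LinearMap.funLeft ℝ ℝ (Subtype.val : B → V) ∘ₗ G.flux ∘ₗ G.vertexValues B)

theorem dtn_apply [Finite V] (G : MetricGraph V F I) (B : Finset V) (p : EuclideanSpace ℝ B)
    (v : B) : G.dtn B p v = G.flux (G.vertexValues B p) v := rfl

theorem isDtNMap_dtn [Finite V] (G : MetricGraph V F I) (B : Finset V) :
    G.IsDtNMap B (G.dtn B) := by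
  intro p q
  simp only [isSolution_iff, exists_eq_left, solution, hasNeumannData_iff]
  constructor
  · rintro rfl v
    rfl
  · intro h
    ext v
    exact (h v).symm

theorem degreeDiag_apply (G : MetricGraph V F I) (B : Finset V) (p : EuclideanSpace ℝ B)
    (v : B) : G.degreeDiag B p v = G.degree v * p v := by
  simp [degreeDiag, Matrix.mulVec_diagonal]

/-- Each edge end at `v` contributes `(coth ℓ - 1) p_v - u(w) / sinh ℓ` to the difference, with
`u(w)` bounded by the maximum principle. -/
theorem norm_dtn_sub_degreeDiag_le [Finite V] (G : MetricGraph V F I) (B : Finset V) {ε : ℝ}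
    (hε : 0 ≤ ε) (h1 : ∀ e, 1 ≤ G.len e) (h2 : ∀ e, Real.exp (-G.len e) ≤ ε) :
    ‖G.dtn B - G.degreeDiag B‖ ≤
      √(Fintype.card B) * (Fintype.card ((F ⊕ I) ⊕ F) * 5) * ε := by
  refine ContinuousLinearMap.opNorm_le_bound _ (by positivity) fun p => ?_
  have hv : ∀ v : B, ‖(G.dtn B - G.degreeDiag B) p v‖ ≤
      Fintype.card ((F ⊕ I) ⊕ F) * 5 * ε * ‖p‖ := by
    intro v
    have e1 : (G.dtn B - G.degreeDiag B) p v = ∑ s with G.endVertex s = v,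
        ((G.endCoth s - 1) * p v
          - G.endCsch s * G.vertexValues B p (G.endVertex (otherEnd s))) := by
      change G.dtn B p v - G.degreeDiag B p v = _
      rw [dtn_apply, degreeDiag_apply, flux_apply, degree, ← nsmul_eq_mul, ← Finset.sum_const,
        ← Finset.sum_sub_distrib, vertexValues_of_mem]
      refine Finset.sum_congr rfl fun s _ => ?_
      ring
    rw [e1]
    refine (norm_sum_le_of_le (n := fun _ => 5 * ε * ‖p‖) _ fun s _ => ?_).trans ?_
    · have b1 := mul_le_mul (G.abs_endCoth_sub_one_le hε h1 h2 s) (PiLp.norm_apply_le p v)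
        (norm_nonneg _) hε
      have b2 := mul_le_mul (G.endCsch_le hε h1 h2 s)
        (G.abs_vertexValues_le B p (G.endVertex (otherEnd s))) (abs_nonneg _) (by positivity)
      refine (norm_sub_le _ _).trans ?_
      rw [norm_mul, norm_mul, Real.norm_eq_abs (G.endCsch s), abs_of_nonneg (G.endCsch_nonneg s),
        Real.norm_eq_abs, Real.norm_eq_abs (G.vertexValues B p _)]
      linarith
    · rw [Finset.sum_const, nsmul_eq_mul]
      have : ((Finset.univ.filter fun s => G.endVertex s = (v : V)).card : ℝ)
          ≤ Fintype.card ((F ⊕ I) ⊕ F) := by exact_mod_cast Finset.card_le_univ _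
      calc _ ≤ (Fintype.card ((F ⊕ I) ⊕ F) : ℝ) * (5 * ε * ‖p‖) := by gcongr
        _ = _ := by ring
  refine (sq_le_sq₀ (norm_nonneg _) (by positivity)).1 ?_
  rw [EuclideanSpace.norm_sq_eq]
  calc ∑ v, ‖(G.dtn B - G.degreeDiag B) p v‖ ^ 2
      ≤ ∑ _v : B, (Fintype.card ((F ⊕ I) ⊕ F) * 5 * ε * ‖p‖) ^ 2 :=
        Finset.sum_le_sum fun v _ => pow_le_pow_left₀ (norm_nonneg _) (hv v) 2
    _ = (√(Fintype.card B) ^ 2) * (Fintype.card ((F ⊕ I) ⊕ F) * 5 * ε * ‖p‖) ^ 2 := by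
        rw [Finset.sum_const, nsmul_eq_mul, Real.sq_sqrt (by positivity), Finset.card_univ]
    _ = _ := by ring

end MetricGraph

end

theorem theorem2p1 {V F I : Type*} [Fintype V] [DecidableEq V] [Fintype F] [Fintype I]
    (G : MetricGraph V F I) (B : Finset V) :
    -- existence and uniqueness of the solution on the scaled graph
    (∀ (μ : ℝ) (hμ : 0 < μ) (p : EuclideanSpace ℝ B),
      ∃! u : (G.scale μ hμ).Sobolev, (G.scale μ hμ).IsSolution B p u) ∧
    -- equivalence of the two norms of the solution, uniformly in `μ` and `p`
    (∃ c C : ℝ, 0 < c ∧ 0 < C ∧ ∀ᶠ μ in atTop, ∀ (hμ : 0 < μ) (p : EuclideanSpace ℝ B)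
      (u : (G.scale μ hμ).Sobolev), (G.scale μ hμ).IsSolution B p u →
        c * (G.scale μ hμ).sqNormL2 u ≤ (G.scale μ hμ).sqNormH2 u ∧
        (G.scale μ hμ).sqNormH2 u ≤ C * (G.scale μ hμ).sqNormL2 u) ∧
    -- bound of the `L²` norm
    (∃ C : ℝ, 0 < C ∧ ∃ r : ℝ → ℝ, r =O[atTop] (fun μ => μ * G.expDecay μ) ∧
      ∀ᶠ μ in atTop, ∀ (hμ : 0 < μ) (p : EuclideanSpace ℝ B)
        (u : (G.scale μ hμ).Sobolev), (G.scale μ hμ).IsSolution B p u →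
          (G.scale μ hμ).sqNormL2 u ≤ C * (1 + r μ) * ‖p‖ ^ 2) ∧
    -- the Dirichlet-to-Neumann map and its asymptotics in the operator norm
    (∃ M : ℝ → (EuclideanSpace ℝ B →L[ℝ] EuclideanSpace ℝ B),
      (∀ (μ : ℝ) (hμ : 0 < μ), (G.scale μ hμ).IsDtNMap B (M μ)) ∧
      (fun μ => M μ - G.degreeDiag B) =O[atTop] G.expDecay) := by
  refine ⟨fun μ hμ p => ?_, ⟨1, 5, one_pos, by norm_num, ?_⟩, ?_, ?_⟩
  · exact ⟨_, (G.scale μ hμ).isSolution_solution B p, fun u hu =>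
      ((G.scale μ hμ).isSolution_iff B p u).1 hu⟩
  · filter_upwards [G.eventually_le_scale_len 6] with μ hlen hμ p u hu
    rw [one_mul]
    refine ⟨(G.scale μ hμ).sqNormL2_le_sqNormH2 u, ?_⟩
    exact (G.scale μ hμ).sqNormH2_le hlen u fun e => neg_add_eq_zero.1 (hu.eqn e)
  · -- The maximum principle bounds the vertex values by `‖p‖` for every `μ`, so that the
    -- remainder can be taken to be zero.
    refine ⟨Fintype.card (F ⊕ I) * 2 + 1, by positivity, 0, isBigO_zero _ _,
      Eventually.of_forall fun μ hμ p u hu => ?_⟩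
    rw [((G.scale μ hμ).isSolution_iff B p u).1 hu, Pi.zero_apply, add_zero, mul_one]
    refine ((G.scale μ hμ).sqNormL2_solution_le B p).trans ?_
    gcongr
    linarith
  · -- The value for `μ ≤ 0` is irrelevant.
    refine ⟨fun μ => if hμ : 0 < μ then (G.scale μ hμ).dtn B else 0, fun μ hμ => ?_, ?_⟩
    · simp only [dif_pos hμ]
      exact (G.scale μ hμ).isDtNMap_dtn B
    · refine IsBigO.of_bound (√(Fintype.card B) * (Fintype.card ((F ⊕ I) ⊕ F) * 5)) ?_
      filter_upwards [G.eventually_le_scale_len 1, eventually_gt_atTop 0] with μ hlen hμ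
      rw [dif_pos hμ, Real.norm_of_nonneg (G.expDecay_nonneg μ)]
      exact (G.scale μ hμ).norm_dtn_sub_degreeDiag_le B (G.expDecay_nonneg μ) hlen
        fun e => G.exp_neg_le_expDecay hμ.le e
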